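/- **Setting.** Let $\mathbf K=(\mathbf K,\otimes,\mathbf 1)$ be a compactly generated tensor triangulated category (TTC). That is, $\mathbf K$ is a triangulated category with a symmetric monoidal product $\otimes$ that is exact in each variable; $\mathbf K$ has all set-indexed coproducts; the isomorphism classes of compact objects (objects $C$ such that $\operatorname{Hom}_{\mathbf K}(C,-)$ commutes with set-indexed coproducts) form a set; for every nonzero $M\in\mathbf K$ there is a compact $C$ with $\operatorname{Hom}_{\mathbf K}(C,M)\neq 0$; the unit $\mathbf 1$ is compact; and every compact object $M$ is rigid, with dual $M^*$. Let $\mathbf K^c$ be the full subcategory of compact objects. A thick tensor ideal of $\mathbf K^c$ is a full triangulated subcategory $\mathbf I$ of $\mathbf K^c$ closed under direct summands such that $M\otimes N\in\mathbf I$ for all $M\in\mathbf I$, $N\in\mathbf K^c$. Let $X$ be a Zariski space: a Noetherian topological space in which every irreducible closed subset has a unique generic point. Let $\mathcal X$ be the set of closed subsets of $X$ and $\mathcal X_{sp}$ the set of specialization closed subsets, i.e. of arbitrary unions of closed subsets. Let $V:\mathbf K^c\to\mathcal X$ be a support data, i.e. for compact objects 1. $V(0)=\varnothing$ and $V(\mathbf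 1)=X$; 2. $V(\bigoplus_{i\in I}M_i)=\bigcup_{i\in I}V(M_i)$ whenever the coproduct $\bigoplus_{i\in I} M_i$ of compact objects is compact; 3. $V(\Sigma M)=V(M)$; 4. $V(N)\subseteq V(M)\cup V(Q)$ for every distinguished triangle $M\to N\to Q\to\Sigma M$; 5. $V(M\otimes N)=V(M)\cap V(N)$; 6. $V(M)=V(M^*)$. Assume moreover that 7. $V(M)=\varnothing$ if and only if $M=0$; 8. for every $W\in\mathcal X$ there is $M\in\mathbf K^c$ with $V(M)=W$. Assume finally that $V$ has an extension to $\mathbf K$: an assignment $\mathcal V:\mathbf K\to\mathcal X_{sp}$ that satisfies (1)--(5) for all objects (and all set-indexed coproducts) of $\mathbf K$, that satisfies $\mathcal V(M)=V(M)$ for all $M\in\mathbf K^c$, and that satisfies (7) on $\mathbf K$ if $V$ satisfies (7) on $\mathbf K^c$. **Theorem.** The assignments $$\Gamma(\mathbf I)=\bigcup_{M\in\mathbf I}V(M),\qquad \Theta(W)=\mathbf I_W=\{M\in\mathbf K^c\mid V(M)\subseteq W\}$$ are well-defined, mutually inverse maps between the set of thick tensor ideals of $\mathbf K^c$ and $\mathcal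 X_{sp}$; that is, $\Gamma(\mathbf I)\in\mathcal X_{sp}$ for every thick tensor ideal $\mathbf I$, $\mathbf I_W$ is a thick tensor ideal for every $W\in\mathcal X_{sp}$, $\Theta(\Gamma(\mathbf I))=\mathbf I$ and $\Gamma(\Theta(W))=W$. -/

import Mathlib

open CategoryTheory CategoryTheory.Limits CategoryTheory.MonoidalCategory Pretriangulated Opposite

universe w v u

namespace TTG

/-! ### Topology -/

section Topology

variable (X : Type w) [TopologicalSpace X]

/-- A Zariski space: a Noetherian topological space in which every irreducible closed subset
has a unique generic point. (Irreducible sets are nonempty.) -/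
class ZariskiSpace : Prop extends TopologicalSpace.NoetherianSpace X where
  existsUnique_genericPoint : ∀ Y : Set X, IsIrreducible Y → IsClosed Y → ∃! y : X, closure {y} = Y

/-- The collection of closed subsets of `X`. -/
def closedSubsets : Set (Set X) := {W | IsClosed W}

/-- The collection of specialization closed subsets of `X`, i.e. arbitrary unions of
closed subsets. -/
def spClosedSubsets : Set (Set X) := {W | ∃ S : Set (Set X), (∀ Z ∈ S, IsClosed Z) ∧ W = ⋃₀ S}

end Topology

/-! ### Compactly generated tensor triangulated categories -/

section Compact

variable (K : Type u) [Category.{v} K] [Preadditive K]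

/-- The compact objects of `K`: those `C` for which the functor `Hom(C, -)` to abelian groups
commutes with set indexed coproducts. -/
def compactObjects : ObjectProperty K := fun C =>
  ∀ ι : Type v, PreservesColimitsOfShape (Discrete ι) (preadditiveCoyoneda.obj (op C))

end Compact

variable (K : Type u) [Category.{v} K] [HasZeroObject K] [HasShift K ℤ] [Preadditive K]
  [∀ n : ℤ, (shiftFunctor K n).Additive] [Pretriangulated K]
  [MonoidalCategory K]

/-- The tensor product is exact in each variable: the functors `M ⊗ -` and `- ⊗ M` can be
equipped with an isomorphism commuting them with the shift so that they preserve distinguished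
triangles. -/
class IsTensorTriangulated : Prop where
  exact_tensorLeft : ∀ M : K,
    ∃ _ : (tensorLeft M).CommShift ℤ, (tensorLeft M).IsTriangulated
  exact_tensorRight : ∀ M : K,
    ∃ _ : (tensorRight M).CommShift ℤ, (tensorRight M).IsTriangulated

/-- `K` is a compactly generated tensor triangulated category. It is meant to be used when `K`
is a triangulated category with a symmetric monoidal structure. -/
class IsCompactlyGeneratedTTC : Prop extends IsTensorTriangulated K where
  hasCoproducts : HasCoproducts.{v} K
  /-- the isomorphism classes of compact objects form a set -/
  essentiallySmall_compact : ObjectProperty.EssentiallySmall.{v} (compactObjects K)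
  /-- the compact objects detect nonzero objects -/
  exists_ne_zero : ∀ M : K, ¬ IsZero M → ∃ C : K, compactObjects K C ∧ ∃ f : C ⟶ M, f ≠ 0
  unit_compact : compactObjects K (𝟙_ K)
  /-- every compact object is rigid -/
  rigid : ∀ M : K, compactObjects K M → ∃ D : K, Nonempty (ExactPairing M D)

variable {K}

/-- A thick tensor ideal of the category `Kᶜ` of compact objects of `K`, seen as a class of
objects of `K`: a full triangulated subcategory of `Kᶜ`, closed under direct summands, and
closed under tensoring with compact objects. -/
structure IsThickTensorIdeal (I : ObjectProperty K) : Prop where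
  le_compact : I ≤ compactObjects K
  triangulated : I.IsTriangulated
  thick : I.IsStableUnderRetracts
  tensor_mem : ∀ M N : K, I M → compactObjects K N → I (M ⊗ N)

/-! ### Support data -/

variable {X : Type w}

/-- The assignment `V` on the objects of the full subcategory `P` of `K`, with values in the
collection `𝒳` of subsets of `X`, satisfies the first five axioms of a support data.
The membership assumptions on `𝟙`, `M ⊗ N` and `M⟦1⟧` hold automatically both for `P = ⊤` and,
in a compactly generated tensor triangulated category, for the compact objects. -/
structure IsPreSupport (P : ObjectProperty K) (𝒳 : Set (Set X)) (V : P.FullSubcategory → Set X) :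
    Prop where
  mem : ∀ M, V M ∈ 𝒳
  zero : ∀ M : P.FullSubcategory, IsZero M.obj → V M = ∅
  unit : ∀ h : P (𝟙_ K), V ⟨𝟙_ K, h⟩ = Set.univ
  coproduct : ∀ {ι : Type v} (M : ι → P.FullSubcategory) (c : Cofan fun i => (M i).obj),
    IsColimit c → ∀ h : P c.pt, V ⟨c.pt, h⟩ = ⋃ i, V (M i)
  shift : ∀ (M : P.FullSubcategory) (h : P (M.obj⟦(1 : ℤ)⟧)), V ⟨M.obj⟦(1 : ℤ)⟧, h⟩ = V M
  triangle : ∀ T : Triangle K, T ∈ distTriang K → ∀ (h₁ : P T.obj₁) (h₂ : P T.obj₂)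
    (h₃ : P T.obj₃), V ⟨T.obj₂, h₂⟩ ⊆ V ⟨T.obj₁, h₁⟩ ∪ V ⟨T.obj₃, h₃⟩
  tensor : ∀ (M N : P.FullSubcategory) (h : P (M.obj ⊗ N.obj)),
    V ⟨M.obj ⊗ N.obj, h⟩ = V M ∩ V N

/-- A support data on the compact objects of `K` with values in the closed subsets of `X`.
The last axiom says `V(M) = V(M*)`, where `M*` is the dual of `M`. -/
structure IsSupportData [TopologicalSpace X] (V : (compactObjects K).FullSubcategory → Set X) :
    Prop extends IsPreSupport (compactObjects K) (closedSubsets X) V where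
  dual : ∀ M D : (compactObjects K).FullSubcategory, Nonempty (ExactPairing M.obj D.obj) →
    V M = V D

/-- `V` detects zero objects. -/
def DetectsZero {P : ObjectProperty K} (V : P.FullSubcategory → Set X) : Prop :=
  ∀ M : P.FullSubcategory, V M = ∅ ↔ IsZero M.obj

/-- `V` realizes every set in the collection `𝒳`. -/
def Realizes {P : ObjectProperty K} (𝒳 : Set (Set X)) (V : P.FullSubcategory → Set X) : Prop :=
  ∀ W ∈ 𝒳, ∃ M : P.FullSubcategory, V M = W

/-- The assignment `E`, from the objects of `K` to specialization closed subsets of `X`,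
extends the support data `V` on the compact objects. -/
structure Extends [TopologicalSpace X] (E : K → Set X)
    (V : (compactObjects K).FullSubcategory → Set X) : Prop where
  preSupport : IsPreSupport (⊤ : ObjectProperty K) (spClosedSubsets X) (fun M => E M.obj)
  eq_on_compact : ∀ M : (compactObjects K).FullSubcategory, E M.obj = V M
  detectsZero : DetectsZero V → DetectsZero (P := (⊤ : ObjectProperty K)) (fun M => E M.obj)

/-- `Γ(I) = ⋃_{M ∈ I} V(M)`. -/
def idealSupport (V : (compactObjects K).FullSubcategory → Set X) (I : ObjectProperty K) : Set X :=
  ⋃ (M : (compactObjects K).FullSubcategory) (_ : I M.obj), V M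

/-- `Θ(W) = I_W`, the class of compact objects `M` with `V(M) ⊆ W`. -/
def supportIdeal (V : (compactObjects K).FullSubcategory → Set X) (W : Set X) : ObjectProperty K :=
  fun M => ∃ h : compactObjects K M, V ⟨M, h⟩ ⊆ W

end TTG

/-! The hard inclusion is Θ(Γ(I)) ⊆ I. Let M be compact with V(M) ⊆ Γ(I). The closed set V(M) has
finitely many irreducible components, and each generic point lies in the support of some object of
I; the direct sum N of these objects satisfies V(M) ⊆ V(N). By the tensor formula and detection of
zero for the extension, N ⊗ F = 0 then forces M ⊗ F = 0 for every F, compact or not.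

It remains to deduce M ∈ I (`IsThickTensorIdeal.mem_of_isZero_tensor`). Let D be dual to N and f : 𝟙
⟶ U the cone map of the evaluation D ⊗ N ⟶ 𝟙, so that N ⊗ f = 0. Take for F the homotopy colimit of
𝟙 → U → U ⊗ U → ⋯. Then N ⊗ F = 0, hence M ⊗ F = 0, and compactness of M makes M ⟶ M ⊗ U^n zero for
some n. The cone of this map is in I, being built from D ⊗ N, and has ΣM as a retract.

Γ(Θ(W)) = W only needs that every closed set is a support. -/

namespace TTG

/-! ### Coproducts and finitely supported maps -/

section Coproducts

variable {K : Type u} [Category.{v} K] [Preadditive K] {ι : Type*} {X : ι → K} {c : Cofan X}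

open Classical in
/-- The projection of a coproduct onto one of its summands. -/
noncomputable def coprodProj (hc : IsColimit c) (i : ι) : c.pt ⟶ X i :=
  Cofan.IsColimit.desc hc fun j => if h : j = i then eqToHom (by rw [h]) else 0

@[simp]
lemma inj_coprodProj_self (hc : IsColimit c) (i : ι) : c.inj i ≫ coprodProj hc i = 𝟙 _ := by
  simp [coprodProj]

lemma inj_coprodProj_of_ne (hc : IsColimit c) {i j : ι} (h : j ≠ i) :
    c.inj j ≫ coprodProj hc i = 0 := by
  simp [coprodProj, h]

open Classical in
/-- The endomorphism of a coproduct which kills the summands in the finite set `s` and is the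
identity on the other ones. -/
noncomputable def killSummands (hc : IsColimit c) (s : Finset ι) : c.pt ⟶ c.pt :=
  Cofan.IsColimit.desc hc fun i => if i ∈ s then 0 else c.inj i

open Classical in
lemma inj_killSummands (hc : IsColimit c) (s : Finset ι) (i : ι) :
    c.inj i ≫ killSummands hc s = if i ∈ s then 0 else c.inj i := by
  simp [killSummands]

open Classical in
lemma killSummands_comp (hc : IsColimit c) (s t : Finset ι) :
    killSummands hc s ≫ killSummands hc t = killSummands hc (s ∪ t) := by
  refine Cofan.IsColimit.hom_ext hc _ _ fun i => ?_
  rw [reassoc_of% (inj_killSummands hc s), inj_killSummands]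
  by_cases hs : i ∈ s <;> by_cases ht : i ∈ t <;> simp [hs, ht, inj_killSummands]

lemma killSummands_coprodProj (hc : IsColimit c) {s : Finset ι} {i : ι} (hi : i ∉ s) :
    killSummands hc s ≫ coprodProj hc i = coprodProj hc i := by
  refine Cofan.IsColimit.hom_ext hc _ _ fun j => ?_
  rw [reassoc_of% (inj_killSummands hc s)]
  by_cases hj : j ∈ s
  · rw [if_pos hj, zero_comp, inj_coprodProj_of_ne hc (by rintro rfl; exact hi hj)]
  · rw [if_neg hj]

/-- The projections onto an infinite coproduct's summands need not sum to the identity;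
`killSummands` is the remainder after finitely many. -/
lemma sum_add_killSummands (hc : IsColimit c) (s : Finset ι) :
    ∑ i ∈ s, coprodProj hc i ≫ c.inj i + killSummands hc s = 𝟙 _ := by
  refine Cofan.IsColimit.hom_ext hc _ _ fun j => ?_
  rw [Preadditive.comp_add, Preadditive.comp_sum, inj_killSummands, Category.comp_id]
  by_cases hj : j ∈ s
  · rw [if_pos hj, add_zero, Finset.sum_eq_single j]
    · simp [reassoc_of% (inj_coprodProj_self hc j)]
    · intro i _ hi
      rw [reassoc_of% (inj_coprodProj_of_ne hc hi.symm), zero_comp]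
    · exact fun h => (h hj).elim
  · rw [if_neg hj, Finset.sum_eq_zero, zero_add]
    intro i hi
    rw [reassoc_of% (inj_coprodProj_of_ne hc fun h : j = i => hj (h ▸ hi)), zero_comp]

lemma coprodProj_eq_zero_of_killSummands (hc : IsColimit c) {s : Finset ι} {C : K} {h : C ⟶ c.pt}
    (hs : h ≫ killSummands hc s = 0) {i : ι} (hi : i ∉ s) : h ≫ coprodProj hc i = 0 := by
  rw [← killSummands_coprodProj hc hi, reassoc_of% hs, zero_comp]

lemma eq_sum_of_killSummands (hc : IsColimit c) {s : Finset ι} {C : K} {h : C ⟶ c.pt}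
    (hs : h ≫ killSummands hc s = 0) : h = ∑ i ∈ s, (h ≫ coprodProj hc i) ≫ c.inj i := by
  conv_lhs => rw [← Category.comp_id h, ← sum_add_killSummands hc s]
  simp [hs, Preadditive.comp_sum]

/-- A functor preserving coproducts transports the endomorphisms `killSummands`. -/
lemma map_killSummands {L : Type*} [Category* L] [Preadditive L] (F : K ⥤ L)
    [F.PreservesZeroMorphisms] (hc : IsColimit c)
    (hc' : IsColimit (Cofan.mk (F.obj c.pt) fun i => F.map (c.inj i) : Cofan fun i => F.obj (X i)))
    (s : Finset ι) :
    F.map (killSummands hc s) = killSummands hc' s := by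
  classical
  refine Cofan.IsColimit.hom_ext hc' _ _ fun i => ?_
  rw [inj_killSummands]
  simp only [Cofan.inj, Cofan.mk_ι_app]
  erw [← F.map_comp, inj_killSummands]
  split_ifs
  · simp
  · rfl

end Coproducts

/-! ### Compactness as finite support of maps into coproducts -/

section Compact

variable {K : Type u} [Category.{v} K] [Preadditive K]

/-- Maps from a compact object to a coproduct have finite support. -/
lemma compactObjects.exists_killSummands {C : K} (hC : compactObjects K C) {ι : Type v} {X : ι → K}
    {c : Cofan X} (hc : IsColimit c) (h : C ⟶ c.pt) :
    ∃ s : Finset ι, h ≫ killSummands hc s = 0 := by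
  classical
  let S : AddSubgroup (C ⟶ c.pt) :=
    { carrier := {h | ∃ s : Finset ι, h ≫ killSummands hc s = 0}
      zero_mem' := ⟨∅, by simp⟩
      add_mem' := by
        rintro a b ⟨s, hs⟩ ⟨t, ht⟩
        refine ⟨s ∪ t, ?_⟩
        rw [Preadditive.add_comp, ← killSummands_comp, reassoc_of% hs, killSummands_comp,
          Finset.union_comm, ← killSummands_comp, reassoc_of% ht]
        simp
      neg_mem' := by
        rintro a ⟨s, hs⟩
        exact ⟨s, by simp [hs]⟩ }
  have := hC ι
  have hc' := isColimitOfPreserves (preadditiveCoyoneda.obj (op C)) hc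
  -- `S` contains every map through a single summand, and such maps determine homomorphisms out of
  -- the coproduct group `C ⟶ c.pt`; so the quotient by `S` is zero.
  have key : AddCommGrpCat.ofHom (QuotientAddGroup.mk' S) =
      (0 : (preadditiveCoyoneda.obj (op C)).obj c.pt ⟶ AddCommGrpCat.of ((C ⟶ c.pt) ⧸ S)) := by
    refine hc'.hom_ext fun i => ?_
    ext g
    refine (QuotientAddGroup.eq_zero_iff _).2 ⟨{i.as}, ?_⟩
    have key (g : C ⟶ X i.as) : (g ≫ c.inj i.as) ≫ killSummands hc {i.as} = 0 := by
      simp [inj_killSummands]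
    exact key g
  have : (QuotientAddGroup.mk' S) h = 0 := congrArg (fun k => k.hom h) key
  exact (QuotientAddGroup.eq_zero_iff _).1 this

/-- If maps from `C` to the coproduct `c` have finite support, families of additive maps out of the
groups `C ⟶ X i` assemble to an additive map out of `C ⟶ c.pt`. -/
noncomputable def coprodHomDesc {C : K} {ι : Type*} {X : ι → K} {c : Cofan X} (hc : IsColimit c)
    (H : ∀ h : C ⟶ c.pt, ∃ s : Finset ι, h ≫ killSummands hc s = 0)
    {A : Type*} [AddCommGroup A] (φ : ∀ i, (C ⟶ X i) →+ A) : (C ⟶ c.pt) →+ A :=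
  -- `finsum` is zero on infinite support, so additivity depends on this.
  have fin (h : C ⟶ c.pt) : (fun i => φ i (h ≫ coprodProj hc i)).HasFiniteSupport := by
    obtain ⟨s, hs⟩ := H h
    refine s.finite_toSet.subset fun i hi => ?_
    by_contra his
    exact hi (by simp [coprodProj_eq_zero_of_killSummands hc hs (by simpa using his)])
  { toFun := fun h => ∑ᶠ i, φ i (h ≫ coprodProj hc i)
    map_zero' := by simp
    map_add' := fun a b => by
      rw [← finsum_add_distrib (fin a) (fin b)]
      simp }

section

variable {C : K} {ι : Type*} {X : ι → K} {c : Cofan X} (hc : IsColimit c)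
    (H : ∀ h : C ⟶ c.pt, ∃ s : Finset ι, h ≫ killSummands hc s = 0)
    {A : Type*} [AddCommGroup A] (φ : ∀ i, (C ⟶ X i) →+ A)

lemma coprodHomDesc_comp_inj (j : ι) (g : C ⟶ X j) :
    coprodHomDesc hc H φ (g ≫ c.inj j) = φ j g := by
  change ∑ᶠ i, φ i ((g ≫ c.inj j) ≫ coprodProj hc i) = _
  rw [finsum_eq_single _ j]
  · simp
  · intro i hi
    simp [inj_coprodProj_of_ne hc hi.symm]

lemma eq_coprodHomDesc (m : (C ⟶ c.pt) →+ A) (hm : ∀ j (g : C ⟶ X j), m (g ≫ c.inj j) = φ j g) :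
    m = coprodHomDesc hc H φ := by
  ext h
  obtain ⟨s, hs⟩ := H h
  rw [eq_sum_of_killSummands hc hs, map_sum, map_sum]
  exact Finset.sum_congr rfl fun i _ => by rw [hm, coprodHomDesc_comp_inj]

end

/-- An object is compact if maps from it to coproducts have finite support. -/
lemma compactObjects.of_exists_killSummands {C : K}
    (H : ∀ {ι : Type v} {X : ι → K} {c : Cofan X} (hc : IsColimit c) (h : C ⟶ c.pt),
      ∃ s : Finset ι, h ≫ killSummands hc s = 0) : compactObjects K C := by
  intro ι
  suffices ∀ X : ι → K, PreservesColimit (Discrete.functor X) (preadditiveCoyoneda.obj (op C)) from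
    preservesColimitsOfShape_of_discrete _
  refine fun X => ⟨fun {c : Cofan X} hc => ⟨?_⟩⟩
  refine (Cofan.isColimitMapCoconeEquiv _ _ _).symm ?_
  refine Cofan.IsColimit.mk _ (fun t => AddCommGrpCat.ofHom
    (coprodHomDesc hc (H hc) fun i => (t.inj i).hom)) ?_ ?_
  · intro t j
    ext g
    exact coprodHomDesc_comp_inj hc (H hc) _ j g
  · intro t m hm
    ext1
    exact eq_coprodHomDesc hc (H hc) _ m.hom fun j g => congrArg (fun k => k.hom g) (hm j)

lemma compactObjects.retract {C D : K} (r : Retract C D) (hD : compactObjects K D) :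
    compactObjects K C := by
  refine .of_exists_killSummands fun hc h => ?_
  obtain ⟨s, hs⟩ := hD.exists_killSummands hc (r.r ≫ h)
  rw [Category.assoc] at hs
  exact ⟨s, by rw [← Category.id_comp h, ← r.retract, Category.assoc, Category.assoc, hs, comp_zero]⟩

/-- A left adjoint functor whose right adjoint preserves coproducts preserves compact objects. -/
lemma compactObjects.leftAdjoint {F G : K ⥤ K} (adj : F ⊣ G) [G.PreservesZeroMorphisms]
    [∀ ι : Type v, PreservesColimitsOfShape (Discrete ι) G] {C : K} (hC : compactObjects K C) :
    compactObjects K (F.obj C) := by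
  refine .of_exists_killSummands fun {ι X c} hc h => ?_
  have hc' := Cofan.isColimitMapCoconeEquiv _ _ _ (isColimitOfPreserves G hc)
  obtain ⟨s, hs⟩ := hC.exists_killSummands hc' (adj.homEquiv _ _ h)
  refine ⟨s, (adj.homEquiv _ _).injective ?_⟩
  rw [adj.homEquiv_naturality_right, map_killSummands G hc hc', adj.homEquiv_unit _ _ 0, G.map_zero,
    comp_zero]
  exact hs

end Compact

/-! ### Telescopes -/

section Telescope

variable {K : Type u} [Category.{v} K] [Preadditive K]

/-- The composite of the first `n` transition maps of a sequence. -/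
def seqComp {X : ℕ → K} (f : ∀ n, X n ⟶ X (n + 1)) : ∀ n, X 0 ⟶ X n
  | 0 => 𝟙 _
  | n + 1 => seqComp f n ≫ f n

/-- The endomorphism `1 - shift` of the coproduct of a sequence, whose cone is the homotopy colimit
of the sequence. -/
def telescope {X : ℕ → K} (f : ∀ n, X n ⟶ X (n + 1)) {c : Cofan fun i : ULift.{v} ℕ => X i.down}
    (hc : IsColimit c) : c.pt ⟶ c.pt :=
  Cofan.IsColimit.desc hc fun i => c.inj i - f i.down ≫ c.inj ⟨i.down + 1⟩

variable {X : ℕ → K} (f : ∀ n, X n ⟶ X (n + 1)) {c : Cofan fun i : ULift.{v} ℕ => X i.down}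
  (hc : IsColimit c)

@[simp]
lemma inj_telescope (i : ULift.{v} ℕ) :
    c.inj i ≫ telescope f hc = c.inj i - f i.down ≫ c.inj ⟨i.down + 1⟩ := by
  simp [telescope]

lemma telescope_eq_id (hf : ∀ n, f n = 0) : telescope f hc = 𝟙 _ :=
  Cofan.IsColimit.hom_ext hc _ _ fun i => by simp [hf]

lemma telescope_coprodProj_zero :
    telescope f hc ≫ coprodProj hc ⟨0⟩ = coprodProj hc ⟨0⟩ := by
  refine Cofan.IsColimit.hom_ext hc _ _ fun i => ?_
  rw [reassoc_of% (inj_telescope f hc i), Preadditive.sub_comp, Category.assoc,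
    inj_coprodProj_of_ne hc (i := ⟨0⟩) (j := ⟨i.down + 1⟩) (by simp [ULift.ext_iff]), comp_zero,
    sub_zero]

lemma telescope_coprodProj_succ (n : ℕ) :
    telescope f hc ≫ coprodProj hc ⟨n + 1⟩ =
      coprodProj hc ⟨n + 1⟩ - coprodProj hc ⟨n⟩ ≫ f n := by
  refine Cofan.IsColimit.hom_ext hc _ _ fun i => ?_
  rw [reassoc_of% (inj_telescope f hc i), Preadditive.sub_comp, Category.assoc,
    Preadditive.comp_sub]
  congr 1
  obtain ⟨i⟩ := i
  by_cases h : i = n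
  · subst h
    rw [inj_coprodProj_self, reassoc_of% (inj_coprodProj_self hc ⟨i⟩)]
    exact Category.comp_id _
  · rw [inj_coprodProj_of_ne hc (by simpa [ULift.ext_iff] using h),
      reassoc_of% (inj_coprodProj_of_ne hc (i := ⟨n⟩) (j := ⟨i⟩) (by simpa [ULift.ext_iff] using h)),
      zero_comp, comp_zero]

/-- If the homotopy colimit of a sequence vanishes, then every map from a compact object to the
first term becomes zero at a later stage. -/
lemma exists_comp_seqComp_eq_zero {C : K} (hC : compactObjects K C) (g : C ⟶ X 0)
    [IsIso (telescope f hc)] : ∃ n, g ≫ seqComp f n = 0 := by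
  obtain ⟨h, hh⟩ : ∃ h : C ⟶ c.pt, h ≫ telescope f hc = g ≫ c.inj ⟨0⟩ :=
    ⟨(g ≫ c.inj ⟨0⟩) ≫ inv (telescope f hc), by simp⟩
  -- The equation for `h`, read coordinatewise, is the recursion h₀ = g, hₙ₊₁ = hₙ ≫ fₙ. Finite
  -- support of `h` then makes some hₙ vanish.
  have key (n : ℕ) : h ≫ coprodProj hc ⟨n⟩ = g ≫ seqComp f n := by
    induction n with
    | zero =>
      rw [← telescope_coprodProj_zero f hc, reassoc_of% hh, inj_coprodProj_self]
      rfl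
    | succ n ih =>
      have := hh =≫ coprodProj hc ⟨n + 1⟩
      rw [Category.assoc, Category.assoc, telescope_coprodProj_succ,
        inj_coprodProj_of_ne hc (by simp [ULift.ext_iff]), comp_zero, Preadditive.comp_sub,
        sub_eq_zero] at this
      rw [this, reassoc_of% ih]
      rfl
  obtain ⟨s, hs⟩ := hC.exists_killSummands hc h
  obtain ⟨n, hn⟩ := Infinite.exists_notMem_finset s
  exact ⟨n.down, by rw [← key]; exact coprodProj_eq_zero_of_killSummands hc hs hn⟩

/-- Functors preserving coproducts commute with the formation of telescopes. -/
lemma map_telescope {L : Type*} [Category.{v} L] [Preadditive L] (F : K ⥤ L) [F.Additive]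
    (hc' : IsColimit (Cofan.mk (F.obj c.pt) fun i => F.map (c.inj i) :
      Cofan fun i : ULift.{v} ℕ => F.obj (X i.down))) :
    F.map (telescope f hc) = telescope (X := fun n => F.obj (X n)) (fun n => F.map (f n)) hc' := by
  refine Cofan.IsColimit.hom_ext hc' _ _ fun i => ?_
  refine Eq.trans ?_ (inj_telescope (X := fun n => F.obj (X n)) _ hc' i).symm
  change F.map (c.inj i) ≫ F.map (telescope f hc) = F.map (c.inj i) -
    F.map (f i.down) ≫ F.map (c.inj ⟨i.down + 1⟩)
  rw [← F.map_comp, inj_telescope, F.map_sub, F.map_comp]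

end Telescope

/-! ### Compact objects of tensor triangulated categories -/

section CompactTriangulated

variable {K : Type u} [Category.{v} K] [HasZeroObject K] [HasShift K ℤ] [Preadditive K]
  [∀ n : ℤ, (shiftFunctor K n).Additive] [Pretriangulated K]

instance : (compactObjects K).IsStableUnderRetracts where
  of_retract r h := h.retract r

/-- Once finitely many summands are killed, the map vanishes on `T.obj₁` and factors through
`T.obj₃`, where killing finitely many more suffices. -/
lemma compactObjects.of_distTriang {T : Triangle K} (hT : T ∈ distTriang K)
    (h₁ : compactObjects K T.obj₁) (h₃ : compactObjects K T.obj₃) :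
    compactObjects K T.obj₂ := by
  classical
  refine .of_exists_killSummands fun hc h => ?_
  obtain ⟨s, hs⟩ := h₁.exists_killSummands hc (T.mor₁ ≫ h)
  obtain ⟨k, hk⟩ := T.yoneda_exact₂ hT (h ≫ killSummands hc s) (by simpa using hs)
  obtain ⟨t, ht⟩ := h₃.exists_killSummands hc k
  exact ⟨s ∪ t, by rw [← killSummands_comp, reassoc_of% hk, ht, comp_zero]⟩

instance : (compactObjects K).IsTriangulated where
  exists_zero := ⟨_, isZero_zero K, .of_exists_killSummands fun _ _ =>
    ⟨∅, (isZero_zero K).eq_of_src _ _⟩⟩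
  isStableUnderShiftBy n := ⟨fun _ h => h.leftAdjoint (shiftEquiv K n).toAdjunction⟩
  ext₂' _ hT h₁ h₃ := ObjectProperty.le_isoClosure _ _ (.of_distTriang hT h₁ h₃)

variable [MonoidalCategory K]

lemma additive_tensorLeft [IsTensorTriangulated K] (M : K) : (tensorLeft M).Additive := by
  obtain ⟨_, _⟩ := IsTensorTriangulated.exact_tensorLeft M
  infer_instance

lemma additive_tensorRight [IsTensorTriangulated K] (M : K) : (tensorRight M).Additive := by
  obtain ⟨_, _⟩ := IsTensorTriangulated.exact_tensorRight M
  infer_instance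

/-- With D dual to N, the functor - ⊗ N is left adjoint to - ⊗ D, which preserves coproducts because
the braiding makes it a left adjoint too. -/
lemma compactObjects.tensor [BraidedCategory K] [IsCompactlyGeneratedTTC K] {M N : K}
    (hM : compactObjects K M) (hN : compactObjects K N) : compactObjects K (M ⊗ N) := by
  obtain ⟨D, ⟨_⟩⟩ := IsCompactlyGeneratedTTC.rigid N hN
  have := BraidedCategory.exactPairing_swap N D
  have := (tensorRightAdjunction D N).leftAdjoint_preservesColimits
  have := additive_tensorRight D
  exact hM.leftAdjoint (tensorRightAdjunction N D)

lemma compactObjects.of_exactPairing [BraidedCategory K] [IsCompactlyGeneratedTTC K] (M D : K)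
    [ExactPairing M D] : compactObjects K D := by
  have := BraidedCategory.exactPairing_swap M D
  have : PreservesColimitsOfSize.{v, v} (tensorLeft M) :=
    (tensorLeftAdjunction D M).leftAdjoint_preservesColimits
  have := additive_tensorLeft M
  exact ((IsCompactlyGeneratedTTC.unit_compact (K := K)).leftAdjoint
    (tensorLeftAdjunction M D)).retract (Iso.retract (ρ_ D).symm)

end CompactTriangulated

/-! ### Thick tensor ideals -/

section Ideals

variable {K : Type u} [Category.{v} K] [HasZeroObject K] [HasShift K ℤ] [Preadditive K]
  [∀ n : ℤ, (shiftFunctor K n).Additive] [Pretriangulated K]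

/-- If a zero morphism has its cone in a thick subcategory, so does its source. -/
lemma mem_of_trW_zero {I : ObjectProperty K} [I.IsTriangulated] [I.IsStableUnderRetracts]
    {X Y : K} (h : I.trW (0 : X ⟶ Y)) : I X := by
  obtain ⟨Z, g, k, hT, hZ⟩ := (I.trW_iff _).1 h
  -- Since the first map is zero, the identity of X⟦1⟧ lifts through the connecting map, so X⟦1⟧ is
  -- a retract of the cone.
  obtain ⟨r, hr⟩ := Triangle.coyoneda_exact₁ _ hT (𝟙 (X⟦(1 : ℤ)⟧))
    ((Category.id_comp _).trans (Functor.map_zero _ _ _))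
  exact (I.prop_shift_iff_of_isStableUnderShift X (1 : ℤ)).1
    (I.prop_of_retract ⟨r, k, hr.symm⟩ hZ)

variable [MonoidalCategory K]

lemma IsThickTensorIdeal.tensor_mem_left [BraidedCategory K] {I : ObjectProperty K}
    (hI : IsThickTensorIdeal I) {M N : K} (hM : compactObjects K M) (hN : I N) : I (M ⊗ N) :=
  have := hI.thick
  I.prop_of_iso (β_ N M) (hI.tensor_mem N M hN hM)

lemma IsThickTensorIdeal.biprod_mem {I : ObjectProperty K}
    (hI : IsThickTensorIdeal I) {M N : K} (hM : I M) (hN : I N) : I (M ⊞ N) :=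
  have := hI.thick
  have := hI.triangulated
  I.ext_of_isTriangulatedClosed₂ _ (binaryBiproductTriangle_distinguished M N) hM hN

lemma trW_whiskerLeft [BraidedCategory K] [IsTensorTriangulated K] {I : ObjectProperty K}
    (hI : IsThickTensorIdeal I) {X Y : K} {f : X ⟶ Y} (hf : I.trW f) {M : K}
    (hM : compactObjects K M) : I.trW (M ◁ f) := by
  obtain ⟨_, _⟩ := IsTensorTriangulated.exact_tensorLeft M
  obtain ⟨Z, g, k, hT, hZ⟩ := (I.trW_iff _).1 hf
  exact .mk _ ((tensorLeft M).map_distinguished _ hT) (hI.tensor_mem_left hM hZ)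

lemma trW_whiskerRight [IsTensorTriangulated K] {I : ObjectProperty K}
    (hI : IsThickTensorIdeal I) {X Y : K} {f : X ⟶ Y} (hf : I.trW f) {M : K}
    (hM : compactObjects K M) : I.trW (f ▷ M) := by
  obtain ⟨_, _⟩ := IsTensorTriangulated.exact_tensorRight M
  obtain ⟨Z, g, k, hT, hZ⟩ := (I.trW_iff _).1 hf
  exact .mk _ ((tensorRight M).map_distinguished _ hT) (hI.tensor_mem _ _ hZ hM)

/-- The iterated tensor powers of `U`. -/
def tensorPow (U : K) : ℕ → K
  | 0 => 𝟙_ K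
  | n + 1 => U ⊗ tensorPow U n

/-- The transition maps between tensor powers of `U` given by a map `𝟙 ⟶ U`. -/
def tensorPowMap {U : K} (f : 𝟙_ K ⟶ U) (n : ℕ) : tensorPow U n ⟶ tensorPow U (n + 1) :=
  (λ_ _).inv ≫ f ▷ tensorPow U n

lemma compactObjects.tensorPow [BraidedCategory K] [IsCompactlyGeneratedTTC K] {U : K}
    (hU : compactObjects K U) (n : ℕ) : compactObjects K (tensorPow U n) := by
  induction n with
  | zero => exact IsCompactlyGeneratedTTC.unit_compact
  | succ n ih => exact hU.tensor ih

/-- The transition maps insert the new factor on the left, so after reassociating `f` stands next to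
N. -/
lemma whiskerLeft_tensorPowMap [IsTensorTriangulated K] {U N : K} {f : 𝟙_ K ⟶ U}
    (hf : N ◁ f = 0) (n : ℕ) : N ◁ tensorPowMap f n = 0 := by
  have : (tensorRight (tensorPow U n)).Additive := additive_tensorRight _
  have h0 : (N ◁ f) ▷ tensorPow U n = 0 := by
    rw [hf]
    exact (tensorRight (tensorPow U n)).map_zero _ _
  have : N ◁ f ▷ tensorPow U n = 0 := by
    rw [← cancel_epi (α_ _ _ _).hom, ← associator_naturality_middle, h0, zero_comp, comp_zero]
  change N ◁ ((λ_ (tensorPow U n)).inv ≫ (f ▷ tensorPow U n : _ ⟶ U ⊗ tensorPow U n)) = 0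
  rw [MonoidalCategory.whiskerLeft_comp, this, comp_zero]

/-- A rigid object is annihilated by the cone map of its evaluation. -/
lemma whiskerLeft_eq_zero_of_evaluation_comp [IsTensorTriangulated K] {N D U : K}
    [ExactPairing N D] {f : 𝟙_ K ⟶ U} (hf : ε_ N D ≫ f = 0) : N ◁ f = 0 := by
  have := additive_tensorLeft N
  have h : N ◁ ε_ N D ≫ N ◁ f = 0 := by
    rw [← MonoidalCategory.whiskerLeft_comp, hf]
    exact (tensorLeft N).map_zero _ _
  -- The zigzag identity makes N ◁ ε a split epimorphism.
  have e := ExactPairing.evaluation_coevaluation N D =≫ N ◁ f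
  simp only [Category.assoc, h, comp_zero] at e
  rw [← cancel_epi (ρ_ N).inv, ← cancel_epi (λ_ N).hom, ← e, comp_zero, comp_zero]

/-- A thick tensor ideal containing `N` contains every compact object `M` which is annihilated by
all the objects annihilating `N`. -/
theorem IsThickTensorIdeal.mem_of_isZero_tensor [IsTriangulated K] [BraidedCategory K]
    [IsCompactlyGeneratedTTC K] {I : ObjectProperty K}
    (hI : IsThickTensorIdeal I) {M N : K} (hM : compactObjects K M) (hN : I N)
    (H : ∀ F : K, IsZero (N ⊗ F) → IsZero (M ⊗ F)) : I M := by
  have := hI.thick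
  have := hI.triangulated
  have hNc := hI.le_compact _ hN
  obtain ⟨D, ⟨_⟩⟩ := IsCompactlyGeneratedTTC.rigid N hNc
  obtain ⟨U, f, k, hT⟩ := distinguished_cocone_triangle (ε_ N D)
  have hDN : I (D ⊗ N) := hI.tensor_mem_left (.of_exactPairing N D) hN
  have hU : compactObjects K U := (compactObjects K).ext_of_isTriangulatedClosed₃ _ hT
    (hI.le_compact _ hDN) IsCompactlyGeneratedTTC.unit_compact
  have hf : I.trW f := .mk' _ hT hDN
  have := IsCompactlyGeneratedTTC.hasCoproducts (K := K)
  let hc := coproductIsCoproduct fun i : ULift.{v} ℕ => tensorPow U i.down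
  obtain ⟨F, p, q, hF⟩ := distinguished_cocone_triangle (telescope (tensorPowMap f) hc)
  -- Tensoring with a rigid A is exact and preserves coproducts, so A ⊗ F is the cone of the
  -- telescope of the sequence tensored with A.
  have key (A : K) (hA : compactObjects K A) :
      ∃ (c : Cofan fun i : ULift.{v} ℕ => A ⊗ tensorPow U i.down) (hc : IsColimit c),
        IsZero (A ⊗ F) ↔ IsIso (telescope (X := fun n => A ⊗ tensorPow U n)
          (fun n => A ◁ tensorPowMap f n) hc) := by
    obtain ⟨A', ⟨_⟩⟩ := IsCompactlyGeneratedTTC.rigid A hA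
    have := BraidedCategory.exactPairing_swap A A'
    have : PreservesColimitsOfSize.{v, v} (tensorLeft A) :=
      (tensorLeftAdjunction A' A).leftAdjoint_preservesColimits
    obtain ⟨_, _⟩ := IsTensorTriangulated.exact_tensorLeft A
    have hc' := Cofan.isColimitMapCoconeEquiv _ _ _ (isColimitOfPreserves (tensorLeft A) hc)
    refine ⟨_, hc', ?_⟩
    have := map_telescope (tensorPowMap f) hc (tensorLeft A) hc'
    have e := Triangle.isZero₃_iff_isIso₁ _ ((tensorLeft A).map_distinguished _ hF)
    refine e.trans ?_
    change IsIso ((tensorLeft A).map (telescope (tensorPowMap f) hc)) ↔ _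
    rw [this]
    rfl
  obtain ⟨cN, hcN, hN'⟩ := key N hNc
  obtain ⟨cM, hcM, hM'⟩ := key M hM
  have : IsIso (telescope (X := fun n => M ⊗ tensorPow U n)
      (fun n => M ◁ tensorPowMap f n) hcM) := by
    refine hM'.1 (H F (hN'.2 ?_))
    have hNf : N ◁ f = 0 :=
      whiskerLeft_eq_zero_of_evaluation_comp (comp_distTriang_mor_zero₁₂ _ hT)
    rw [telescope_eq_id _ _ (whiskerLeft_tensorPowMap hNf)]
    infer_instance
  obtain ⟨n, hn⟩ := exists_comp_seqComp_eq_zero (X := fun n => M ⊗ tensorPow U n)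
    (fun n => M ◁ tensorPowMap f n) hcM hM
    (ρ_ M).inv
  have hW (n : ℕ) : I.trW
      -- Each transition map has its cone in I because f does; the octahedral axiom handles
      -- composites.
      (seqComp (X := fun n => M ⊗ tensorPow U n) (fun n => M ◁ tensorPowMap f n) n) := by
    induction n with
    | zero => exact I.trW_of_isIso (𝟙 _)
    | succ n ih =>
      refine I.trW.comp_mem _ _ ih (trW_whiskerLeft hI ?_ hM)
      exact I.trW.comp_mem _ _ (I.trW_of_isIso _) (trW_whiskerRight hI hf (hU.tensorPow n))
  refine mem_of_trW_zero (I := I) (X := M) (Y := M ⊗ tensorPow U n) ?_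
  rw [← hn]
  exact I.trW.comp_mem _ _ (I.trW_of_isIso (ρ_ M).inv) (hW n)

end Ideals

/-! ### Supports -/

section Support

variable {K : Type u} [Category.{v} K] [HasZeroObject K] [HasShift K ℤ] [Preadditive K]
  [∀ n : ℤ, (shiftFunctor K n).Additive] [Pretriangulated K] [MonoidalCategory K]
  {X : Type w} {P : ObjectProperty K} {𝒳 : Set (Set X)} {V : P.FullSubcategory → Set X}

/-- Isomorphism invariance is not an axiom: N is a coproduct of the one-term family M. -/
lemma IsPreSupport.congr_iso (hV : IsPreSupport P 𝒳 V) {M N : P.FullSubcategory}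
    (e : M.obj ≅ N.obj) : V M = V N := by
  have := hV.coproduct (ι := PUnit) (fun _ => M) (Cofan.mk N.obj fun _ => e.hom)
    (Cofan.IsColimit.mk _ (fun t => e.inv ≫ t.inj ⟨⟩) (fun t j => by simp [Cofan.inj])
      fun t m hm => by rw [← hm ⟨⟩]; simp [Cofan.inj]) N.property
  exact (this.trans (Set.iUnion_const _)).symm

lemma IsPreSupport.biprod (hV : IsPreSupport P 𝒳 V) {M N L : P.FullSubcategory}
    (e : L.obj ≅ M.obj ⊞ N.obj) : V L = V M ∪ V N := by
  have := hV.coproduct (ι := ULift Bool) (fun b => cond b.down M N)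
    (Cofan.mk L.obj fun b => match b with
      | ⟨true⟩ => biprod.inl ≫ e.inv
      | ⟨false⟩ => biprod.inr ≫ e.inv)
    (Cofan.IsColimit.mk _
      (fun t => e.hom ≫ biprod.desc (t.inj ⟨true⟩) (t.inj ⟨false⟩))
      (by rintro t ⟨_ | _⟩ <;> simp [Cofan.inj])
      (by
        intro t m hm
        rw [← Iso.inv_comp_eq]
        refine biprod.hom_ext' _ _ ?_ ?_
        · rw [biprod.inl_desc, ← hm ⟨true⟩]
          simp [Cofan.inj]
        · rw [biprod.inr_desc, ← hm ⟨false⟩]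
          simp [Cofan.inj])) L.property
  refine this.trans ?_
  ext x
  simp [ULift.exists, or_comm]

/-- The cone of the split inclusion is a complement of M in N, and it stays in P. -/
lemma IsPreSupport.retract_subset [P.IsTriangulated] [P.IsStableUnderRetracts]
    (hV : IsPreSupport P 𝒳 V) {M N : P.FullSubcategory} (r : Retract M.obj N.obj) :
    V M ⊆ V N := by
  obtain ⟨Q, g, k, hT⟩ := distinguished_cocone_triangle r.i
  have hQ : P Q := P.ext_of_isTriangulatedClosed₃ _ hT M.property N.property
  have : Mono r.i := (SplitMono.mk r.r r.retract).mono
  obtain ⟨e, -, -⟩ := exists_iso_binaryBiproduct_of_distTriang _ hT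
    (Triangle.mor₃_eq_zero_of_mono₁ _ hT this)
  rw [hV.biprod (M := M) (N := ⟨Q, hQ⟩) e]
  exact Set.subset_union_left

lemma IsPreSupport.shift_int [P.IsTriangulated] [P.IsStableUnderRetracts]
    (hV : IsPreSupport P 𝒳 V) (n : ℤ) (M : P.FullSubcategory) (h : P (M.obj⟦n⟧)) :
    V ⟨M.obj⟦n⟧, h⟩ = V M := by
  induction n with
  | zero => exact hV.congr_iso ((shiftFunctorZero K ℤ).app M.obj)
  | succ n ih =>
    have h' := P.le_shift (n : ℤ) _ M.property
    rw [← ih h', ← hV.shift ⟨_, h'⟩ (P.le_shift (1 : ℤ) _ h')]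
    exact hV.congr_iso ((shiftFunctorAdd K (n : ℤ) 1).app M.obj)
  | pred n ih =>
    have h' := P.le_shift (-n : ℤ) _ M.property
    -- Going down, the shift axiom is applied to M⟦-n - 1⟧, whose shift by 1 is M⟦-n⟧.
    rw [← ih h', ← hV.shift ⟨_, h⟩ (P.le_shift (1 : ℤ) _ h)]
    exact hV.congr_iso ((shiftFunctorAdd' K (-n - 1 : ℤ) 1 (-n) (by ring)).app M.obj).symm

end Support

/-! ### Ideals and specialization closed subsets -/

section Classification

variable {K : Type u} [Category.{v} K] [HasZeroObject K] [HasShift K ℤ] [Preadditive K]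
  [∀ n : ℤ, (shiftFunctor K n).Additive] [Pretriangulated K] [MonoidalCategory K]
  {X : Type w} {V : (compactObjects K).FullSubcategory → Set X}

lemma isThickTensorIdeal_supportIdeal [BraidedCategory K] [IsCompactlyGeneratedTTC K]
    {𝒳 : Set (Set X)} (hV : IsPreSupport (compactObjects K) 𝒳 V) (W : Set X) :
    IsThickTensorIdeal (supportIdeal V W) := by
  have thick : (supportIdeal V W).IsStableUnderRetracts :=
    { of_retract := fun r ⟨h, hW⟩ => ⟨h.retract r,
        (hV.retract_subset (M := ⟨_, h.retract r⟩) (N := ⟨_, h⟩) r).trans hW⟩ }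
  refine ⟨fun M h => h.1, ?_, thick, ?_⟩
  · exact
    { exists_zero := by
        obtain ⟨Z, hZ, hZc⟩ := (compactObjects K).exists_prop_of_containsZero
        exact ⟨Z, hZ, hZc, by simp [hV.zero ⟨Z, hZc⟩ hZ]⟩
      isStableUnderShiftBy := fun n => ⟨fun M ⟨h, hW⟩ =>
        ⟨(compactObjects K).le_shift n _ h, (hV.shift_int n ⟨M, h⟩ _).trans_subset hW⟩⟩
      ext₂' := fun T hT ⟨h₁, hW₁⟩ ⟨h₃, hW₃⟩ => ObjectProperty.le_isoClosure _ _
        ⟨.of_distTriang hT h₁ h₃, (hV.triangle T hT h₁ _ h₃).trans (Set.union_subset hW₁ hW₃)⟩ }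
  · rintro M N ⟨hM, hW⟩ hN
    exact ⟨hM.tensor hN, by
      rw [hV.tensor ⟨M, hM⟩ ⟨N, hN⟩]
      exact Set.inter_subset_left.trans hW⟩

variable [TopologicalSpace X]

/-- A closed subset of the support of a thick tensor ideal is contained in the support of a single
object of the ideal. -/
lemma exists_mem_subset_support [ZariskiSpace X]
    (hV : IsPreSupport (compactObjects K) (closedSubsets X) V)
    {I : ObjectProperty K} (hI : IsThickTensorIdeal I) {Z : Set X} (hZ : IsClosed Z)
    (hZI : Z ⊆ idealSupport V I) :
    ∃ N : (compactObjects K).FullSubcategory, I N.obj ∧ Z ⊆ V N := by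
  obtain ⟨S, hS, hSc, hSi, rfl⟩ :=
    TopologicalSpace.NoetherianSpace.exists_finite_set_isClosed_irreducible hZ
  clear hZ
  induction S, hS using Set.Finite.induction_on with
  | empty =>
    have := hI.triangulated
    have := hI.thick
    exact ⟨⟨_, hI.le_compact _ (I.prop_of_isZero (isZero_zero K))⟩,
      I.prop_of_isZero (isZero_zero K), by simp⟩
  | @insert Y S _ _ ih =>
    rw [Set.sUnion_insert, Set.union_subset_iff] at hZI
    obtain ⟨N, hN, hSN⟩ := ih (fun t ht => hSc t (Set.mem_insert_of_mem _ ht))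
      (fun t ht => hSi t (Set.mem_insert_of_mem _ ht)) hZI.2
    obtain ⟨y, hy, -⟩ := ZariskiSpace.existsUnique_genericPoint Y
      (hSi Y (Set.mem_insert _ _)) (hSc Y (Set.mem_insert _ _))
    have hyY : y ∈ Y := hy ▸ subset_closure rfl
    obtain ⟨N', hN', hyN'⟩ : ∃ N', I N'.obj ∧ y ∈ V N' := by
      simpa [idealSupport] using hZI.1 hyY
    have hNN' := hI.biprod_mem hN' hN
    refine ⟨⟨_, hI.le_compact _ hNN'⟩, hNN', ?_⟩
    rw [hV.biprod (M := N') (N := N) (Iso.refl _), Set.sUnion_insert]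
    refine Set.union_subset_union ?_ hSN
    rw [← hy]
    -- V(N') is closed, so containing the generic point it contains all of Y.
    exact closure_minimal (by simpa using hyN') (hV.mem N')

/-- This is where the extension of V is used: the F needed later is a homotopy colimit, which need
not be compact. -/
lemma Extends.isZero_tensor_of_subset {E : K → Set X} (hE : Extends E V) (hV : DetectsZero V)
    {M N : (compactObjects K).FullSubcategory} (h : V M ⊆ V N) (F : K)
    (hF : IsZero (N.obj ⊗ F)) : IsZero (M.obj ⊗ F) := by
  have tensor (A : K) : E (A ⊗ F) = E A ∩ E F :=
    hE.preSupport.tensor ⟨A, trivial⟩ ⟨F, trivial⟩ trivial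
  have zero (A : K) : E A = ∅ ↔ IsZero A := hE.detectsZero hV ⟨A, trivial⟩
  rw [← zero, tensor, hE.eq_on_compact] at hF ⊢
  exact Set.subset_eq_empty (Set.inter_subset_inter_left _ h) hF

end Classification

end TTG

theorem theoremI (K : Type u) [Category.{v} K] [HasZeroObject K] [HasShift K ℤ] [Preadditive K]
    [∀ n : ℤ, (shiftFunctor K n).Additive] [Pretriangulated K] [IsTriangulated K]
    [MonoidalCategory K] [SymmetricCategory K] [TTG.IsCompactlyGeneratedTTC K]
    (X : Type w) [TopologicalSpace X] [TTG.ZariskiSpace X]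
    (V : (TTG.compactObjects K).FullSubcategory → Set X)
    (hV : TTG.IsSupportData V)
    (hV_zero : TTG.DetectsZero V)
    (hV_real : TTG.Realizes (TTG.closedSubsets X) V)
    (E : K → Set X) (hE : TTG.Extends E V) :
    Set.MapsTo (TTG.idealSupport V) {I : ObjectProperty K | TTG.IsThickTensorIdeal I}
      (TTG.spClosedSubsets X) ∧
    Set.MapsTo (TTG.supportIdeal V) (TTG.spClosedSubsets X)
      {I : ObjectProperty K | TTG.IsThickTensorIdeal I} ∧
    Set.InvOn (TTG.supportIdeal V) (TTG.idealSupport V)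
      {I : ObjectProperty K | TTG.IsThickTensorIdeal I} (TTG.spClosedSubsets X) := by
  have hV' := hV.toIsPreSupport
  refine ⟨fun I _ => ⟨V '' {M | I M.obj}, ?_, ?_⟩, fun W _ =>
    TTG.isThickTensorIdeal_supportIdeal hV' W, fun I hI => ?_, ?_⟩
  · rintro _ ⟨M, -, rfl⟩
    exact hV'.mem M
  · rw [Set.sUnion_image]
    rfl
  · refine le_antisymm ?_ fun M hM => ?_
    · rintro M ⟨hM, hMI⟩
      obtain ⟨N, hN, hMN⟩ := TTG.exists_mem_subset_support hV' hI (hV'.mem ⟨M, hM⟩) hMI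
      exact hI.mem_of_isZero_tensor hM hN (hE.isZero_tensor_of_subset hV_zero hMN)
    · have hMc := hI.le_compact _ hM
      exact ⟨hMc, Set.subset_iUnion₂_of_subset (⟨M, hMc⟩ : (TTG.compactObjects K).FullSubcategory)
        hM subset_rfl⟩
  · rintro _ ⟨S, hS, rfl⟩
    refine Set.Subset.antisymm (Set.iUnion₂_subset fun M hM => hM.2)
      (Set.sUnion_subset fun Z hZ => ?_)
    -- A compact object with support exactly Z ⊆ W lies in I_W and covers Z.
    obtain ⟨M, rfl⟩ := hV_real Z (hS Z hZ)
    exact Set.subset_iUnion₂_of_subset M ⟨M.property, Set.subset_sUnion_of_mem hZ⟩ subset_rfl
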